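/- Let $E$ be an Archimedean vector lattice over $\mathbb{R}$. A net $(x_\alpha)_{\alpha\in A}$ in $E$ is order convergent to $x\in E$ if there is a net $(y_\beta)_{\beta\in B}$ in $E$ with $y_\beta\downarrow 0$ such that for every $\beta\in B$ there is an $\alpha_0\in A$ with $|x_\alpha-x|\le y_\beta$ for all $\alpha\ge\alpha_0$; a subset of $E$ is order closed if it contains the limits of all order convergent nets of its elements. A set $V\subseteq E$ is solid if $x\in V$ and $|y|\le|x|$ imply $y\in V$. For $S\subseteq E$ let $S^{\mathrm d}=\{x\in E:|x|\wedge|s|=0\text{ for all }s\in S\}$. Let $\tau$ be a Fatou topology on $E$, that is, a Hausdorff linear topology such that zero has a neighbourhood basis consisting of order closed solid subsets of $E$. The carrier $C_\tau$ of $\tau$ is the union of the sets $\bigl(\bigcap_{n\ge1}V_n\bigr)^{\mathrm d}$, where $(V_n)_{n\ge1}$ runs over all sequences of solid $\tau$-neighbourhoods of zero with $V_{n+1}+V_{n+1}\subseteq V_n$ for all $n$. Suppose that $C_\tau$ has a countable order basis, i.e. that there is a non-empty, at most countable set $A\subseteq C_\tau$ such that $A^{\mathrm d}\cap C_\tau=\{0\}$.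 Then $C_\tau=E$. -/

import Mathlib

open scoped Topology Pointwise

/-- Archimedean property of an ordered additive group: if `0 ≤ x` and all multiples `n • x` are
bounded above by one element, then `x = 0`.  (Mathlib's class `Archimedean` is a different, much
more restrictive property when the order is not total.) -/
def ArchimedeanLattice (E : Type*) [AddCommGroup E] [Lattice E] : Prop :=
  ∀ x y : E, 0 ≤ x → (∀ n : ℕ, n • x ≤ y) → x = 0

/-- Order convergence of a net `x`, indexed by `A`, to `a`: there is a net `y`, indexed by some
directed set `B`, that decreases to `0` and such that, for every `b`, eventually
`|x α - a| ≤ y b`.  Only the range of `y` matters, and this is a set of elements of `E`; hence it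
is no restriction to take `B` in the universe of `E`. -/
def OrderConverges.{u, v} {E : Type u} [AddCommGroup E] [Lattice E] {A : Type v} [Preorder A]
    (x : A → E) (a : E) : Prop :=
  ∃ (B : Type u) (_ : Preorder B) (_ : IsDirectedOrder B) (_ : Nonempty B) (y : B → E),
    Antitone y ∧ IsGLB (Set.range y) 0 ∧
      ∀ b : B, ∃ α₀ : A, ∀ α : A, α₀ ≤ α → |x α - a| ≤ y b

/-- A set is order closed when it contains the limit of every order convergent net of its elements.
If a net in `S` order converges to `a` by means of `y`, then a choice, for every `d` in the range
of `y`, of a term of the net at distance at most `d` from `a` is a net in `S`, indexed by the range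
of `y`, that also order converges to `a`; hence index sets in the universe of `E` suffice. -/
def OrderClosed.{u} {E : Type u} [AddCommGroup E] [Lattice E] (S : Set E) : Prop :=
  ∀ (A : Type u) [Preorder A] [IsDirectedOrder A] [Nonempty A] (x : A → E) (a : E),
    (∀ α, x α ∈ S) → OrderConverges x a → a ∈ S

/-- The disjoint complement of a set. -/
def disjointComplement {E : Type*} [AddCommGroup E] [Lattice E] (S : Set E) : Set E :=
  {x | ∀ s ∈ S, |x| ⊓ |s| = 0}

/-- `A` is an order basis of the vector sublattice `F`: a non-empty subset of `F` whose disjoint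
complement in `F` is `{0}`. -/
def IsOrderBasisOf {E : Type*} [AddCommGroup E] [Lattice E] (A F : Set E) : Prop :=
  A.Nonempty ∧ A ⊆ F ∧ disjointComplement A ∩ F = {0}

/-- A Fatou topology: a Hausdorff linear topology for which zero has a neighbourhood basis
consisting of order closed solid sets. -/
structure IsFatouTopology {E : Type*} [AddCommGroup E] [Lattice E] [Module ℝ E]
    (τ : TopologicalSpace E) : Prop where
  topologicalAddGroup : IsTopologicalAddGroup E
  continuousSMul : ContinuousSMul ℝ E
  t2Space : T2Space E
  hasBasis : (𝓝 (0 : E)).HasBasis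
    (fun V : Set E => V ∈ 𝓝 (0 : E) ∧ LatticeOrderedAddCommGroup.IsSolid V ∧ OrderClosed V) id

/-- A normal sequence of solid neighbourhoods of zero. -/
structure IsNormalSolidSeq {E : Type*} [AddCommGroup E] [Lattice E] (τ : TopologicalSpace E)
    (V : ℕ → Set E) : Prop where
  mem_nhds : ∀ n, V n ∈ 𝓝 (0 : E)
  solid : ∀ n, LatticeOrderedAddCommGroup.IsSolid (V n)
  add_subset : ∀ n, V (n + 1) + V (n + 1) ⊆ V n

/-- The carrier of a topology: the union of the disjoint complements of the intersections of the
normal sequences of solid neighbourhoods of zero. -/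
def topologyCarrier {E : Type*} [AddCommGroup E] [Lattice E] (τ : TopologicalSpace E) : Set E :=
  {x | ∃ V : ℕ → Set E, IsNormalSolidSeq τ V ∧ x ∈ disjointComplement (⋂ n, V n)}

section VectorLattice

variable {E : Type*} [AddCommGroup E] [Lattice E]

/-! The carrier is order dense: given `x > 0`, take a normal sequence of order closed sets whose
first set misses `x`, with intersection the ideal `N`. If no nonzero carrier element lay in `[0,
x]`, then `x` would be disjoint from `Nᵈ`, hence by the Archimedean property the supremum of `N ∩
[0, x]`, and order closedness would put `x` in the first set. The countable basis comes from
countably many normal sequences, which one sequence refines. Its intersection is disjoint from the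
basis, so by order density it is `{0}`, whose disjoint complement is `E`. -/

theorem IsNormalSolidSeq.zero_mem {τ : TopologicalSpace E} {V : ℕ → Set E}
    (hV : IsNormalSolidSeq τ V) (n : ℕ) : (0 : E) ∈ V n :=
  mem_of_mem_nhds (hV.mem_nhds n)

theorem IsNormalSolidSeq.antitone {τ : TopologicalSpace E} {V : ℕ → Set E}
    (hV : IsNormalSolidSeq τ V) : Antitone V :=
  antitone_nat_of_succ_le fun n x hx =>
    hV.add_subset n ⟨x, hx, 0, hV.zero_mem (n + 1), add_zero x⟩

theorem IsNormalSolidSeq.add_mem_iInter {τ : TopologicalSpace E} {V : ℕ → Set E}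
    (hV : IsNormalSolidSeq τ V) {x y : E} (hx : x ∈ ⋂ n, V n) (hy : y ∈ ⋂ n, V n) :
    x + y ∈ ⋂ n, V n := by
  rw [Set.mem_iInter] at *
  exact fun n => hV.add_subset n ⟨x, hx _, y, hy _, rfl⟩

theorem IsNormalSolidSeq.solid_iInter {τ : TopologicalSpace E} {V : ℕ → Set E}
    (hV : IsNormalSolidSeq τ V) : LatticeOrderedAddCommGroup.IsSolid (⋂ n, V n) := by
  intro x hx y hy
  rw [Set.mem_iInter] at *
  exact fun n => hV.solid n (hx n) hy

/-- Countably many normal sequences are refined by a single one. -/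
theorem exists_isNormalSolidSeq_iInter_subset {τ : TopologicalSpace E} {V : ℕ → ℕ → Set E}
    (hV : ∀ i, IsNormalSolidSeq τ (V i)) :
    ∃ W : ℕ → Set E, IsNormalSolidSeq τ W ∧ ∀ i, ⋂ n, W n ⊆ ⋂ n, V i n := by
  -- Diagonal choice: each stage intersects only finitely many neighbourhoods, and the index sets
  -- grow with `n`.
  refine ⟨fun n => ⋂ i ∈ Set.Iic n, V i n, ⟨fun n => ?_, fun n x hx y hy => ?_, ?_⟩, ?_⟩
  · exact (Filter.biInter_mem (Set.finite_Iic n)).2 fun i _ => (hV i).mem_nhds n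
  · rw [Set.mem_iInter₂] at *
    exact fun i hi => (hV i).solid n (hx i hi) hy
  · rintro n _ ⟨x, hx, y, hy, rfl⟩
    rw [Set.mem_iInter₂] at *
    intro i hi
    have hi' : i ∈ Set.Iic (n + 1) := Nat.le_succ_of_le hi
    exact (hV i).add_subset n ⟨x, hx i hi', y, hy i hi', rfl⟩
  · intro i x hx
    rw [Set.mem_iInter] at *
    intro n
    have := Set.mem_iInter₂.1 (hx (max i n)) i (le_max_left i n)
    exact (hV i).antitone (le_max_right i n) this

/-- Inside every neighbourhood of zero of a Fatou topology there is a normal sequence of order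
closed solid neighbourhoods of zero. -/
theorem IsFatouTopology.exists_isNormalSolidSeq [Module ℝ E] {τ : TopologicalSpace E}
    (hτ : IsFatouTopology τ) {U : Set E} (hU : U ∈ 𝓝 (0 : E)) :
    ∃ V : ℕ → Set E, IsNormalSolidSeq τ V ∧ (∀ n, OrderClosed (V n)) ∧ V 0 ⊆ U := by
  have := hτ.topologicalAddGroup
  have step : ∀ W : Set E, W ∈ 𝓝 (0 : E) → ∃ V : Set E, (V ∈ 𝓝 (0 : E) ∧
      LatticeOrderedAddCommGroup.IsSolid V ∧ OrderClosed V) ∧ V + V ⊆ W := by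
    intro W hW
    obtain ⟨T, hT, hTW⟩ := exists_nhds_zero_half hW
    obtain ⟨V, hV, hVT⟩ := hτ.hasBasis.mem_iff.1 hT
    refine ⟨V, hV, ?_⟩
    rintro _ ⟨x, hx, y, hy, rfl⟩
    exact hTW x (hVT hx) y (hVT hy)
  choose! f hf hfW using step
  -- The exponent starts at `1` because `U` itself need not be solid or order closed.
  let V : ℕ → Set E := fun n => f^[n + 1] U
  have hVs : ∀ n, V (n + 1) = f (V n) := fun n => Function.iterate_succ_apply' f (n + 1) U
  have hV : ∀ n, V n ∈ 𝓝 (0 : E) ∧ LatticeOrderedAddCommGroup.IsSolid (V n) ∧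
      OrderClosed (V n) := by
    intro n
    induction n with
    | zero => exact hf U hU
    | succ n ih => rw [hVs]; exact hf _ ih.1
  refine ⟨V, ⟨fun n => (hV n).1, fun n => (hV n).2.1, fun n => ?_⟩, fun n => (hV n).2.2, ?_⟩
  · rw [hVs]; exact hfW _ (hV n).1
  · exact fun x hx => hfW U hU ⟨x, hx, 0, mem_of_mem_nhds (hV 0).1, add_zero x⟩

variable [IsOrderedAddMonoid E]

/-- In an Archimedean vector lattice, a positive element that is disjoint from the disjoint
complement of an ideal `N` is the supremum of the elements of `N` below it. -/
theorem isLUB_of_disjoint_disjointComplement (hE : ArchimedeanLattice E) {N : Set E}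
    (hsolid : LatticeOrderedAddCommGroup.IsSolid N)
    (hadd : ∀ ⦃y⦄, y ∈ N → ∀ ⦃z⦄, z ∈ N → y + z ∈ N) (hzero : (0 : E) ∈ N) {x : E} (hx : 0 ≤ x)
    (hdisj : ∀ w ∈ disjointComplement N, |w| ⊓ x = 0) :
    IsLUB {y | y ∈ N ∧ 0 ≤ y ∧ y ≤ x} x := by
  refine ⟨fun y hy => hy.2.2, fun u hu => ?_⟩
  have hux : ∀ y ∈ N, 0 ≤ y → y ≤ x → y ≤ u ⊓ x := fun y hN h0 hle => le_inf (hu ⟨hN, h0, hle⟩) hle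
  have hw : 0 ≤ x - u ⊓ x := sub_nonneg.2 inf_le_right
  have hu0 : 0 ≤ u ⊓ x := hux 0 hzero le_rfl hx
  -- Elements of `N ∩ [0, x]` lie below `u ⊓ x`, so adding `d` keeps them below `x`; hence all
  -- multiples of `d` do.
  have hmem : x - u ⊓ x ∈ disjointComplement N := by
    intro z hz
    rw [abs_of_nonneg hw]
    set d := (x - u ⊓ x) ⊓ |z| with hd
    have hd0 : 0 ≤ d := le_inf hw (abs_nonneg z)
    have hdN : d ∈ N := hsolid hz (by rw [abs_of_nonneg hd0]; exact inf_le_right)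
    refine hE d x hd0 fun n => ?_
    have key : ∀ n : ℕ, n • d ∈ N ∧ n • d ≤ x := by
      intro n
      induction n with
      | zero => simpa using ⟨hzero, hx⟩
      | succ n ih =>
        rw [succ_nsmul]
        refine ⟨hadd ih.1 hdN, ?_⟩
        calc n • d + d ≤ u ⊓ x + (x - u ⊓ x) :=
              add_le_add (hux _ ih.1 (nsmul_nonneg hd0 n) ih.2) inf_le_left
          _ = x := add_sub_cancel _ _
    exact (key n).2
  have h := hdisj _ hmem
  rw [abs_of_nonneg hw, inf_eq_left.2 (sub_le_self x hu0), sub_eq_zero] at h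
  exact inf_eq_right.1 h.symm

/-- A positive element is the order limit of the elements below it in an ideal, as soon as it is
their supremum. -/
theorem OrderClosed.mem_of_isLUB {N S : Set E} (hS : OrderClosed S) (hNS : N ⊆ S)
    (hsolid : LatticeOrderedAddCommGroup.IsSolid N)
    (hadd : ∀ ⦃y⦄, y ∈ N → ∀ ⦃z⦄, z ∈ N → y + z ∈ N) (hzero : (0 : E) ∈ N) {x : E} (hx : 0 ≤ x)
    (hlub : IsLUB {y | y ∈ N ∧ 0 ≤ y ∧ y ≤ x} x) : x ∈ S := by
  let D := {y : E // y ∈ N ∧ 0 ≤ y ∧ y ≤ x}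
  have hdir : IsDirectedOrder D := ⟨fun a b => by
    have h0 : 0 ≤ a.1 ⊔ b.1 := a.2.2.1.trans le_sup_left
    refine ⟨⟨a.1 ⊔ b.1, hsolid (hadd a.2.1 b.2.1) ?_, h0, sup_le a.2.2.2 b.2.2.2⟩,
      le_sup_left (a := a.1), le_sup_right (b := b.1)⟩
    rw [abs_of_nonneg h0, abs_of_nonneg (add_nonneg a.2.2.1 b.2.2.1)]
    exact sup_le (le_add_of_nonneg_right b.2.2.1) (le_add_of_nonneg_left a.2.2.1)⟩
  have hne : Nonempty D := ⟨⟨0, hzero, le_rfl, hx⟩⟩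
  refine hS D (fun d => d.1) x (fun d => hNS d.2.1)
    ⟨D, inferInstance, hdir, hne, fun d => x - d.1, fun a b hab => sub_le_sub_left (Subtype.coe_le_coe.2 hab) x, ⟨?_, ?_⟩,
      fun b => ⟨b, fun a hba => ?_⟩⟩
  · rintro _ ⟨d, rfl⟩
    exact sub_nonneg.2 d.2.2.2
  · intro l hl
    have : x ≤ x - l := hlub.2 fun y hy => le_sub_comm.1 (hl ⟨⟨y, hy⟩, rfl⟩)
    simpa using this
  · rw [abs_sub_comm, abs_of_nonneg (sub_nonneg.2 a.2.2.2)]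
    exact sub_le_sub_left (Subtype.coe_le_coe.2 hba) x

theorem disjointComplement_solid (S : Set E) :
    LatticeOrderedAddCommGroup.IsSolid (disjointComplement S) := fun _ hx y hy s hs =>
  le_antisymm ((inf_le_inf_right _ hy).trans (hx s hs).le) (le_inf (abs_nonneg y) (abs_nonneg s))

/-- The carrier of a Fatou topology on an Archimedean vector lattice is order dense. -/
theorem IsFatouTopology.exists_mem_topologyCarrier [Module ℝ E] (hE : ArchimedeanLattice E)
    {τ : TopologicalSpace E} (hτ : IsFatouTopology τ) {x : E} (hx : 0 ≤ x) (hx0 : x ≠ 0) :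
    ∃ y ∈ topologyCarrier τ, 0 ≤ y ∧ y ≤ x ∧ y ≠ 0 := by
  have := hτ.t2Space
  obtain ⟨V, hV, hclosed, hVU⟩ := hτ.exists_isNormalSolidSeq (isOpen_ne.mem_nhds hx0.symm)
  by_contra! hcon
  have hzero : (0 : E) ∈ ⋂ n, V n := Set.mem_iInter.2 hV.zero_mem
  have hadd : ∀ ⦃y⦄, y ∈ ⋂ n, V n → ∀ ⦃z⦄, z ∈ ⋂ n, V n → y + z ∈ ⋂ n, V n :=
    fun y hy z hz => hV.add_mem_iInter hy hz
  refine hVU ((hclosed 0).mem_of_isLUB (Set.iInter_subset V 0) hV.solid_iInter hadd hzero hx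
    (isLUB_of_disjoint_disjointComplement hE hV.solid_iInter hadd hzero hx fun w hw => ?_)) rfl
  have h0 : 0 ≤ |w| ⊓ x := le_inf (abs_nonneg w) hx
  -- By solidity `|w| ⊓ x` is a carrier element below `x`, so it vanishes.
  refine hcon _ ⟨V, hV, disjointComplement_solid _ hw ?_⟩ h0 inf_le_right
  rw [abs_of_nonneg h0]
  exact inf_le_left

end VectorLattice

theorem mainTheorem11 {E : Type*} [AddCommGroup E] [Lattice E] [IsOrderedAddMonoid E]
    [Module ℝ E] [IsOrderedModule ℝ E] (hE : ArchimedeanLattice E)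
    (τ : TopologicalSpace E) (hτ : IsFatouTopology τ)
    (hbasis : ∃ A : Set E, A.Countable ∧ IsOrderBasisOf A (topologyCarrier τ)) :
    topologyCarrier τ = Set.univ := by
  obtain ⟨A, hcount, hne, hAC, hbasis⟩ := hbasis
  obtain ⟨a, rfl⟩ := hcount.exists_eq_range hne
  choose V hV haV using fun i => hAC ⟨i, rfl⟩
  obtain ⟨W, hW, hWV⟩ := exists_isNormalSolidSeq_iInter_subset hV
  have hWzero : ∀ x ∈ ⋂ n, W n, x = 0 := by
    intro x hx
    by_contra hx0
    obtain ⟨y, hyC, hy0, hyx, hy⟩ := hτ.exists_mem_topologyCarrier hE (abs_nonneg x)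
      fun h => hx0 (le_antisymm (h ▸ le_abs_self x)
        (neg_nonpos.1 (h ▸ neg_le_abs x)))
    have hxA : x ∈ disjointComplement (Set.range a) := by
      rintro _ ⟨i, rfl⟩
      rw [inf_comm]
      exact haV i x (hWV i hx)
    have hyA : y ∈ disjointComplement (Set.range a) :=
      disjointComplement_solid _ hxA (by rwa [abs_of_nonneg hy0])
    have hmem : y ∈ disjointComplement (Set.range a) ∩ topologyCarrier τ := ⟨hyA, hyC⟩
    rw [hbasis] at hmem
    exact hy hmem
  refine Set.eq_univ_of_forall fun x => ⟨W, hW, fun s hs => ?_⟩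
  rw [hWzero s hs, abs_zero]
  exact inf_eq_right.2 (abs_nonneg x)
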